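/- Let $g \ge 2$ be an even integer, and let $f = a_{2g+1}X^{2g+1} + a_{2g}X^{2g} + \cdots + a_0 \in \mathbb{Q}[X]$ be a squarefree polynomial of degree exactly $2g+1$. Let $C/\mathbb{Q}$ be the smooth projective curve of genus $g$ with affine model $Y^2 = f(X)$ (it has a single point at infinity), and let $J$ be the Jacobian of $C$. Suppose $J(\mathbb{Q}) = 0$. Then $C$ has no points of degree $g+1$; that is, there is no point $P \in C(\overline{\mathbb{Q}})$ with $[\mathbb{Q}(P):\mathbb{Q}] = g+1$. -/

import Mathlib

open Polynomial

noncomputable section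

/-! ### The affine curve `y² = h(x)` over a field and its coordinate ring -/

/-- The coordinate ring `K[x, y] / (y² - h(x))` of the affine plane curve `y² = h(x)`. -/
abbrev DoubleCoverRing {K : Type*} [Field K] (h : K[X]) : Type _ :=
  AdjoinRoot ((X : K[X][X]) ^ 2 - C h)

namespace DoubleCoverRing

variable {K : Type*} [Field K] (h : K[X])

/-- The coordinate function `x`. -/
def x : DoubleCoverRing h := algebraMap K[X] (DoubleCoverRing h) X

/-- The coordinate function `y`. -/
def y : DoubleCoverRing h := AdjoinRoot.root _

lemma y_sq : y h ^ 2 = algebraMap K[X] (DoubleCoverRing h) h := by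
  have := AdjoinRoot.eval₂_root ((X : K[X][X]) ^ 2 - C h)
  simp only [eval₂_sub, eval₂_pow, eval₂_X, eval₂_C, sub_eq_zero] at this
  exact this

/-- Evaluation of functions at the point `(a, b)` of the affine curve. -/
def evalAt (a b : K) (hab : b ^ 2 = h.eval a) : DoubleCoverRing h →+* K :=
  AdjoinRoot.lift (evalRingHom a) b (by simp [hab])

lemma evalAt_algebraMap (a b : K) (hab : b ^ 2 = h.eval a) (p : K[X]) :
    evalAt h a b hab (algebraMap K[X] _ p) = p.eval a :=
  AdjoinRoot.lift_of _

lemma monic : ((X : K[X][X]) ^ 2 - C h).Monic := monic_X_pow_sub_C h two_ne_zero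

instance : Module.Finite K[X] (DoubleCoverRing h) := .of_basis (AdjoinRoot.powerBasis' (monic h)).basis

lemma algebraMap_injective : Function.Injective (algebraMap K[X] (DoubleCoverRing h)) :=
  AdjoinRoot.of.injective_of_degree_ne_zero (by rw [degree_X_pow_sub_C two_pos]; decide)

/-- Every function on the affine curve is of the form `p(x) + q(x) y`. -/
lemma exists_rep (r : DoubleCoverRing h) :
    ∃ p q : K[X], r = algebraMap K[X] _ p + algebraMap K[X] _ q * y h := by
  obtain ⟨P, rfl⟩ := AdjoinRoot.mk_surjective r
  induction P using Polynomial.induction_on' with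
  | add P Q hP hQ =>
    obtain ⟨p, q, hp⟩ := hP
    obtain ⟨p', q', hq⟩ := hQ
    exact ⟨p + p', q + q', by rw [map_add, hp, hq]; simp only [map_add]; ring⟩
  | monomial n a =>
    have key : AdjoinRoot.mk ((X : K[X][X]) ^ 2 - C h) (monomial n a)
        = algebraMap K[X] _ a * y h ^ n := by
      rw [← C_mul_X_pow_eq_monomial, map_mul, map_pow]; rfl
    rcases Nat.even_or_odd' n with ⟨k, rfl | rfl⟩
    · exact ⟨a * h ^ k, 0, by rw [key, pow_mul, y_sq]; simp⟩
    · refine ⟨0, a * h ^ k, key.trans ?_⟩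
      have e : y h ^ (2 * k + 1) = (y h ^ 2) ^ k * y h := by ring
      rw [e, y_sq, map_zero, zero_add, map_mul, map_pow, mul_assoc]

/-- The involution `(x, y) ↦ (x, -y)`, on functions. -/
def conj : DoubleCoverRing h →ₐ[K[X]] DoubleCoverRing h :=
  AdjoinRoot.liftAlgHom _ (Algebra.ofId _ _) (-y h) (by
    simp only [eval₂_sub, eval₂_pow, eval₂_X, eval₂_C, neg_sq, y_sq]
    exact sub_self _)

lemma conj_y : conj h (y h) = -y h := AdjoinRoot.liftAlgHom_root ..

lemma conj_injective : Function.Injective (conj h) := by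
  have : ∀ r, conj h (conj h r) = r := by
    intro r
    obtain ⟨p, q, rfl⟩ := exists_rep h r
    simp only [map_add, map_mul, AlgHom.commutes, conj_y, map_neg, neg_neg]
  exact Function.LeftInverse.injective this

lemma exists_norm (r : DoubleCoverRing h) : ∃ n : K[X], r * conj h r = algebraMap K[X] _ n := by
  obtain ⟨p, q, rfl⟩ := exists_rep h r
  refine ⟨p ^ 2 - q ^ 2 * h, ?_⟩
  simp only [map_add, map_mul, AlgHom.commutes, conj_y, map_sub, map_pow, ← y_sq]
  ring

/-! The curve `y² = h(x)` is smooth and geometrically irreducible when `h` is separable of positive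
degree; for the coordinate ring to be a Dedekind domain it suffices that `h` is squarefree. -/

variable [H : Fact (Squarefree h ∧ 0 < h.natDegree)]

instance : IsDomain (DoubleCoverRing h) := by
  apply AdjoinRoot.isDomain_of_prime
  apply Irreducible.prime
  have hd : ((X : K[X][X]) ^ 2 - C h).natDegree = 2 := natDegree_X_pow_sub_C
  rw [Monic.irreducible_iff_roots_eq_zero_of_degree_le_three (monic h) (by omega) (by omega)]
  rw [Multiset.eq_zero_iff_forall_notMem]
  intro r hr
  have hr : r ^ 2 = h := by
    have := (mem_roots'.1 hr).2
    simpa [sub_eq_zero] using this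
  have hu : IsUnit r := H.out.1 r ⟨1, by rw [← hr]; ring⟩
  have := natDegree_eq_zero_of_isUnit (hu.pow 2)
  rw [hr] at this
  exact absurd H.out.2 (by omega)

lemma exists_isCoprime_mul {n q : K[X]} (hn : n ≠ 0) :
    ∃ d n' q' : K[X], IsCoprime n' q' ∧ n = d * n' ∧ q = d * q' := by
  classical
  obtain ⟨n', hn'⟩ := EuclideanDomain.gcd_dvd_right q n
  obtain ⟨q', hq'⟩ := EuclideanDomain.gcd_dvd_left q n
  have hb := EuclideanDomain.gcd_eq_gcd_ab q n
  have hd : EuclideanDomain.gcd q n ≠ 0 := fun e ↦ hn (EuclideanDomain.gcd_eq_zero_iff.1 e).2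
  generalize EuclideanDomain.gcd q n = d at *
  refine ⟨d, n', q', ⟨EuclideanDomain.gcdB q n, EuclideanDomain.gcdA q n, ?_⟩, hn', hq'⟩
  generalize EuclideanDomain.gcdB q n = v at *
  generalize EuclideanDomain.gcdA q n = u at *
  apply mul_left_cancel₀ hd
  rw [hn', hq'] at hb
  linear_combination -hb

/-- A squarefree denominator cannot cancel a square. -/
lemma dvd_of_sq_dvd {n q : K[X]} (hn : n ≠ 0) (hq : n ^ 2 ∣ q ^ 2 * h) : n ∣ q := by
  obtain ⟨d, n', q', hcop, rfl, rfl⟩ := exists_isCoprime_mul (q := q) hn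
  have hd : d ≠ 0 := left_ne_zero_of_mul hn
  have h1 : n' ^ 2 ∣ q' ^ 2 * h := by
    rw [mul_pow, mul_pow, mul_assoc] at hq
    exact (mul_dvd_mul_iff_left (pow_ne_zero 2 hd)).1 hq
  have h2 : n' ^ 2 ∣ h := (hcop.pow).dvd_of_dvd_mul_left h1
  have h3 : IsUnit n' := H.out.1 n' (by rwa [← sq])
  exact mul_dvd_mul_left _ h3.dvd

/-- If `(p + q y) / n` and `(p - q y) / n` are integral over `K[x]`, then `n` divides `p`, `q`. -/
lemma dvd_of_isIntegral [NeZero (2 : K)] {F : Type*} [Field F] [Algebra K[X] F]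
    (hinj : Function.Injective (algebraMap K[X] F)) {Y : F} (hY : Y ^ 2 = algebraMap K[X] F h)
    {p q n : K[X]} (hn : n ≠ 0)
    (h1 : IsIntegral K[X]
      ((algebraMap K[X] F p + algebraMap K[X] F q * Y) / algebraMap K[X] F n))
    (h2 : IsIntegral K[X]
      ((algebraMap K[X] F p - algebraMap K[X] F q * Y) / algebraMap K[X] F n)) :
    n ∣ p ∧ n ∣ q := by
  set a : K[X] →+* F := algebraMap K[X] F with ha
  have hnF : a n ≠ 0 := by rwa [Ne, map_eq_zero_iff _ hinj]
  have h2K : (2 : K) ≠ 0 := NeZero.ne 2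
  have hprod : a (C (2⁻¹ : K)) * 2 = 1 := by
    have : (2 : F) = a (C 2) := by
      rw [show (C (2 : K) : K[X]) = 2 from map_ofNat C 2, map_ofNat]
    rw [this, ← map_mul, ← C_mul, inv_mul_cancel₀ h2K, C_1, map_one]
  have h2F0 : (2 : F) ≠ 0 := right_ne_zero_of_mul_eq_one hprod
  have hhalf : IsIntegral K[X] ((2 : F)⁻¹) := by
    rw [← eq_inv_of_mul_eq_one_left hprod]
    exact isIntegral_algebraMap
  have descend : ∀ u : K[X], ∀ k : ℕ, IsIntegral K[X] (a u / a n ^ k) → n ^ k ∣ u := by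
    intro u k hu
    have hinjG : Function.Injective (algebraMap K[X] (FractionRing K[X])) :=
      IsFractionRing.injective _ _
    let j : FractionRing K[X] →ₐ[K[X]] F :=
      IsFractionRing.liftAlgHom (g := Algebra.ofId K[X] F) hinj
    have hj : j (algebraMap _ _ u / algebraMap _ _ n ^ k) = a u / a n ^ k := by
      rw [map_div₀, map_pow, AlgHom.commutes, AlgHom.commutes]
    rw [← hj] at hu
    have hu' := (isIntegral_algHom_iff j j.toRingHom.injective).1 hu
    obtain ⟨w, hw⟩ := IsIntegrallyClosed.algebraMap_eq_of_integral hu'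
    refine ⟨w, hinjG ?_⟩
    have hn1 : algebraMap K[X] (FractionRing K[X]) n ≠ 0 := by
      rwa [Ne, map_eq_zero_iff _ hinjG]
    rw [map_mul, map_pow, hw, mul_div_cancel₀]
    exact pow_ne_zero _ hn1
  constructor
  · have e : a p / a n ^ 1 = ((a p + a q * Y) / a n + (a p - a q * Y) / a n) * 2⁻¹ := by
      field_simp; ring
    have := descend p 1 (by rw [e]; exact (h1.add h2).mul hhalf)
    simpa using this
  · have e : a (q ^ 2 * h) / a n ^ 2
        = (((a p + a q * Y) / a n - (a p - a q * Y) / a n) * 2⁻¹) ^ 2 := by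
      rw [map_mul, map_pow, ← hY]; field_simp; ring
    exact dvd_of_sq_dvd h hn (descend _ 2 (by rw [e]; exact ((h1.sub h2).mul hhalf).pow 2))

theorem exists_eq_of_isIntegral [NeZero (2 : K)] {F : Type*} [Field F]
    [Algebra (DoubleCoverRing h) F] [IsFractionRing (DoubleCoverRing h) F]
    [Algebra K[X] F] [IsScalarTower K[X] (DoubleCoverRing h) F] (z : F)
    (hz : IsIntegral (DoubleCoverRing h) z) : ∃ r, algebraMap (DoubleCoverRing h) F r = z := by
  have hzA : IsIntegral K[X] z := isIntegral_trans z hz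
  have hinjF : Function.Injective (algebraMap (DoubleCoverRing h) F) := IsFractionRing.injective _ _
  have tow : ∀ p : K[X], algebraMap (DoubleCoverRing h) F (algebraMap K[X] _ p)
      = algebraMap K[X] F p := fun p ↦ (IsScalarTower.algebraMap_apply ..).symm
  have hinj : Function.Injective (algebraMap K[X] F) := by
    rw [IsScalarTower.algebraMap_eq K[X] (DoubleCoverRing h) F]
    exact hinjF.comp (algebraMap_injective h)
  -- the conjugate of an integral element is integral
  let τ : F →+* F := IsFractionRing.lift (A := DoubleCoverRing h) (K := F) (L := F)
    (g := (algebraMap (DoubleCoverRing h) F).comp (conj h).toRingHom)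
    (hinjF.comp (conj_injective h))
  have hτ : ∀ r, τ (algebraMap _ F r) = algebraMap _ F (conj h r) := fun r ↦
    IsFractionRing.lift_algebraMap _ _
  have hτA : ∀ p : K[X], τ (algebraMap K[X] F p) = algebraMap K[X] F p := fun p ↦ by
    rw [← tow, hτ, AlgHom.commutes]
  have hτz : IsIntegral K[X] (τ z) := hzA.map (⟨τ, hτA⟩ : F →ₐ[K[X]] F)
  obtain ⟨r, s, hs, rfl⟩ := IsFractionRing.div_surjective (A := DoubleCoverRing h) z
  have hs0 : s ≠ 0 := nonZeroDivisors.ne_zero hs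
  have hcs0 : conj h s ≠ 0 := by
    rwa [Ne, map_eq_zero_iff _ (conj_injective h)]
  obtain ⟨n, hn⟩ := exists_norm h s
  obtain ⟨p, q, hpq⟩ := exists_rep h (r * conj h s)
  have hn0 : n ≠ 0 := by
    rintro rfl
    rw [map_zero] at hn
    exact (mul_ne_zero hs0 hcs0) hn
  have hnF : algebraMap K[X] F n ≠ 0 := by rwa [Ne, map_eq_zero_iff _ hinj]
  have hsF : algebraMap (DoubleCoverRing h) F s ≠ 0 := by rwa [Ne, map_eq_zero_iff _ hinjF]
  have hY : algebraMap (DoubleCoverRing h) F (y h) ^ 2 = algebraMap K[X] F h := by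
    rw [← map_pow, y_sq, tow]
  have hτY : τ (algebraMap _ F (y h)) = -algebraMap _ F (y h) := by rw [hτ, conj_y, map_neg]
  have e1 := congrArg (algebraMap (DoubleCoverRing h) F) hn
  have e2 := congrArg (algebraMap (DoubleCoverRing h) F) hpq
  rw [map_mul, tow] at e1
  rw [map_mul, map_add, map_mul, tow, tow] at e2
  have hz' : algebraMap _ F r / algebraMap _ F s
      = (algebraMap K[X] F p + algebraMap K[X] F q * algebraMap _ F (y h)) /
        algebraMap K[X] F n := by
    rw [div_eq_div_iff hsF hnF, ← e1, ← e2]; ring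
  rw [hz'] at hzA hτz ⊢
  rw [map_div₀, map_add, map_mul, hτA, hτA, hτA, hτY, mul_neg, ← sub_eq_add_neg] at hτz
  obtain ⟨⟨p', rfl⟩, ⟨q', rfl⟩⟩ := dvd_of_isIntegral h hinj hY hn0 hzA hτz
  refine ⟨algebraMap K[X] _ p' + algebraMap K[X] _ q' * y h, ?_⟩
  rw [map_add, map_mul, tow, tow, map_mul, map_mul, eq_div_iff hnF]
  ring

instance [NeZero (2 : K)] : IsDedekindDomain (DoubleCoverRing h) :=
  have : IsDedekindRing (DoubleCoverRing h) :=
    (isDedekindRing_iff (DoubleCoverRing h) (FractionRing (DoubleCoverRing h))).2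
      ⟨inferInstance, Ring.DimensionLEOne.of_isIntegral K[X] _,
        fun hz ↦ exists_eq_of_isIntegral h _ hz⟩
  {}

/-- The point `(a, b)` of the affine curve `y² = h(x)`, as a maximal ideal of the
coordinate ring: the functions vanishing at the point. -/
def pointIdeal [NeZero (2 : K)] (a b : K) (hab : b ^ 2 = h.eval a) :
    IsDedekindDomain.HeightOneSpectrum (DoubleCoverRing h) where
  asIdeal := RingHom.ker (evalAt h a b hab)
  isPrime := RingHom.ker_isPrime _
  ne_bot := by
    intro e
    have : algebraMap K[X] (DoubleCoverRing h) (X - C a) ∈ RingHom.ker (evalAt h a b hab) := by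
      rw [RingHom.mem_ker, evalAt_algebraMap]; simp
    rw [e, Ideal.mem_bot, map_eq_zero_iff _ (algebraMap_injective h)] at this
    exact X_sub_C_ne_zero a this

end DoubleCoverRing

/-! ### Odd degree hyperelliptic curves over `ℚ` -/

/-- The field of algebraic numbers. -/
abbrev Qbar : Type := AlgebraicClosure ℚ

/-- The smooth projective curve of genus `g` over `ℚ` with affine model `Y² = f(X)`, where
`f ∈ ℚ[X]` has degree exactly `2g + 1` and is squarefree (that is, the model is smooth, so that
the curve has genus `g`). -/
structure OddHyperellipticCurve (g : ℕ) where
  f : ℚ[X]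
  natDegree_f : f.natDegree = 2 * g + 1
  squarefree_f : Squarefree f

namespace OddHyperellipticCurve

variable {g : ℕ} (C : OddHyperellipticCurve g)

/-- The polynomial `f`, with coefficients regarded as algebraic numbers. -/
def fBar : Qbar[X] := C.f.map (algebraMap ℚ Qbar)

/-- The polynomial `T ^ (2g + 2) f(1/T)`. The curve is the union of the affine curves `Y² = f(X)`
and `S² = T ^ (2g + 2) f(1/T)`, glued along `T = 1/X` and `S = Y/X ^ (g + 1)`. -/
def fInfty : Qbar[X] := C.fBar.reflect (2 * g + 2)

lemma natDegree_fBar : C.fBar.natDegree = 2 * g + 1 := by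
  rw [fBar, natDegree_map, C.natDegree_f]

lemma squarefree_fBar : Squarefree C.fBar :=
  (PerfectField.separable_iff_squarefree.2 C.squarefree_f).map.squarefree

lemma fBar_ne_zero : C.fBar ≠ 0 := C.squarefree_fBar.ne_zero

lemma coeff_zero_fInfty : C.fInfty.coeff 0 = 0 := by
  rw [fInfty, coeff_reflect, revAt_le (Nat.zero_le _)]
  exact coeff_eq_zero_of_natDegree_lt (by rw [natDegree_fBar]; omega)

lemma coeff_one_fInfty : C.fInfty.coeff 1 ≠ 0 := by
  rw [fInfty, coeff_reflect, revAt_le (by omega),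
    show 2 * g + 2 - 1 = C.fBar.natDegree by rw [natDegree_fBar]; omega]
  exact leadingCoeff_ne_zero.2 C.fBar_ne_zero

lemma squarefree_fInfty : Squarefree C.fInfty := by
  rintro p ⟨q, hpq⟩
  have h0 : C.fInfty ≠ 0 := fun e ↦ C.coeff_one_fInfty (by rw [e, coeff_zero])
  have hp0 : p ≠ 0 := by rintro rfl; simp [hpq] at h0
  have hq0 : q ≠ 0 := by rintro rfl; simp [hpq] at h0
  have hdeg : p.natDegree + p.natDegree + q.natDegree ≤ 2 * g + 2 := by
    rw [← natDegree_mul hp0 hp0, ← natDegree_mul (mul_ne_zero hp0 hp0) hq0, ← hpq]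
    refine natDegree_reflect_le.trans ?_
    rw [natDegree_fBar]; simp
  set a := p.natDegree with ha
  have e : C.fBar = p.reflect a * p.reflect a * q.reflect (2 * g + 2 - (a + a)) := by
    rw [← reflect_mul p p le_rfl le_rfl, ← reflect_mul (p * p) q
      (natDegree_mul_le_of_le le_rfl le_rfl) (by omega), ← hpq,
      show a + a + (2 * g + 2 - (a + a)) = 2 * g + 2 by omega, fInfty, reflect_reflect]
  have hu := C.squarefree_fBar _ ⟨_, e⟩
  obtain ⟨c, hc, hc'⟩ := Polynomial.isUnit_iff.1 hu
  have hpX : p = Polynomial.C c * X ^ a := by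
    rw [← reflect_C, hc', reflect_reflect]
  rcases Nat.eq_zero_or_pos a with h | h
  · rw [hpX, h, pow_zero, mul_one]; exact hc.map Polynomial.C
  · exfalso
    apply C.coeff_one_fInfty
    have : X ^ 2 ∣ C.fInfty := by
      rw [hpq, sq]
      exact (mul_dvd_mul (hpX ▸ (dvd_pow_self X h.ne').mul_left _)
        (hpX ▸ (dvd_pow_self X h.ne').mul_left _)).mul_right _
    exact X_pow_dvd_iff.1 this 1 (by norm_num)

instance : Fact (Squarefree C.fBar ∧ 0 < C.fBar.natDegree) :=
  ⟨C.squarefree_fBar, by rw [natDegree_fBar]; omega⟩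

instance : Fact (Squarefree C.fInfty ∧ 0 < C.fInfty.natDegree) :=
  ⟨C.squarefree_fInfty, Nat.pos_of_ne_zero fun e ↦ C.coeff_one_fInfty
    (coeff_eq_zero_of_natDegree_lt (by omega))⟩

/-- The function field `Qbar(C)`: the fraction field of `Qbar[X, Y] / (Y² - f(X))`. -/
abbrev FunctionField : Type := FractionRing (DoubleCoverRing C.fBar)

/-- The fraction field of the coordinate ring `Qbar[T, S] / (S² - T ^ (2g + 2) f(1/T))` of the
chart around the point at infinity. -/
abbrev FunctionFieldInfty : Type := FractionRing (DoubleCoverRing C.fInfty)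

/-- The function `T` on the chart at infinity. -/
def T : C.FunctionFieldInfty := algebraMap _ _ (DoubleCoverRing.x C.fInfty)

/-- The function `S` on the chart at infinity. -/
def S : C.FunctionFieldInfty := algebraMap _ _ (DoubleCoverRing.y C.fInfty)

/-- The change of charts `X ↦ 1/T` on polynomials in `X`. -/
def polyToInfty : Qbar[X] →+* C.FunctionFieldInfty :=
  eval₂RingHom (algebraMap Qbar C.FunctionFieldInfty) C.T⁻¹

lemma aeval_T (p : Qbar[X]) :
    p.eval₂ (algebraMap Qbar C.FunctionFieldInfty) C.T =
      algebraMap (DoubleCoverRing C.fInfty) _ (algebraMap Qbar[X] _ p) := by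
  rw [T, DoubleCoverRing.x, IsScalarTower.algebraMap_eq Qbar (DoubleCoverRing C.fInfty)
    C.FunctionFieldInfty, ← hom_eval₂, IsScalarTower.algebraMap_eq Qbar Qbar[X]
    (DoubleCoverRing C.fInfty), ← hom_eval₂]
  congr 2
  exact eval₂_C_X

lemma T_ne_zero : C.T ≠ 0 := by
  rw [T, DoubleCoverRing.x, Ne, map_eq_zero_iff _ (IsFractionRing.injective _ _),
    map_eq_zero_iff _ (DoubleCoverRing.algebraMap_injective _)]
  exact X_ne_zero

lemma polyToInfty_mul_pow (p : Qbar[X]) (N : ℕ) (hp : p.natDegree ≤ N) :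
    C.polyToInfty p * C.T ^ N =
      algebraMap (DoubleCoverRing C.fInfty) _ (algebraMap Qbar[X] _ (p.reflect N)) := by
  let _ : Invertible C.T := invertibleOfNonzero C.T_ne_zero
  have h := eval₂_reflect_mul_pow (algebraMap Qbar C.FunctionFieldInfty) C.T N (p.reflect N)
    (natDegree_reflect_le.trans (max_le le_rfl hp))
  rw [reflect_reflect, aeval_T, invOf_eq_inv] at h
  exact h

lemma polyToInfty_injective : Function.Injective C.polyToInfty := by
  rw [injective_iff_map_eq_zero]
  intro p hp
  have h := C.polyToInfty_mul_pow p p.natDegree le_rfl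
  rw [hp, zero_mul, eq_comm, map_eq_zero_iff _ (IsFractionRing.injective _ _),
    map_eq_zero_iff _ (DoubleCoverRing.algebraMap_injective _)] at h
  exact reflect_eq_zero_iff.1 h

lemma polyToInfty_fBar : (C.S / C.T ^ (g + 1)) ^ 2 = C.polyToInfty C.fBar := by
  have h := C.polyToInfty_mul_pow C.fBar (2 * g + 2) (by rw [natDegree_fBar]; omega)
  rw [show C.fBar.reflect (2 * g + 2) = C.fInfty from rfl, ← DoubleCoverRing.y_sq, map_pow] at h
  rw [div_pow, div_eq_iff (pow_ne_zero _ (pow_ne_zero _ C.T_ne_zero)), ← pow_mul,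
    show (g + 1) * 2 = 2 * g + 2 by ring, h, S]

/-- The change of charts `X ↦ 1/T`, `Y ↦ S/T ^ (g + 1)` on the affine coordinate ring. -/
def ringToInfty : DoubleCoverRing C.fBar →+* C.FunctionFieldInfty :=
  AdjoinRoot.lift C.polyToInfty (C.S / C.T ^ (g + 1)) (by
    simp only [eval₂_sub, eval₂_pow, eval₂_X, eval₂_C, polyToInfty_fBar, sub_self])

lemma ringToInfty_injective : Function.Injective C.ringToInfty := by
  rw [injective_iff_map_eq_zero]
  intro r hr
  obtain ⟨n, hn⟩ := DoubleCoverRing.exists_norm _ r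
  have h := congrArg C.ringToInfty hn
  have h' : C.ringToInfty (algebraMap Qbar[X] _ n) = C.polyToInfty n := AdjoinRoot.lift_of _
  rw [map_mul, hr, zero_mul, h', eq_comm, map_eq_zero_iff _ C.polyToInfty_injective] at h
  rw [h, map_zero, mul_eq_zero, map_eq_zero_iff _ (DoubleCoverRing.conj_injective _), or_self] at hn
  exact hn

/-- The change of charts, on rational functions: the identification of the two descriptions of the
function field, given by `X ↦ 1/T` and `Y ↦ S/T ^ (g + 1)`. -/
def toInfty : C.FunctionField →+* C.FunctionFieldInfty :=
  IsFractionRing.lift C.ringToInfty_injective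

/-- The set `C(Qbar)` of points of the smooth projective curve: the points `(x, y)` of the affine
model, together with the single point at infinity `(T, S) = (0, 0)`. -/
inductive Point
  | affine (x y : Qbar) (h : y ^ 2 = C.fBar.eval x)
  | infinity

/-- The normalized valuation at a point of the curve, on the function field. -/
def valuationAt : C.Point → Valuation C.FunctionField (WithZero (Multiplicative ℤ))
  | .affine x y h => (DoubleCoverRing.pointIdeal C.fBar x y h).valuation C.FunctionField
  | .infinity => ((DoubleCoverRing.pointIdeal C.fInfty 0 0
      (by rw [← coeff_zero_eq_eval_zero, coeff_zero_fInfty]; simp)).valuation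
        C.FunctionFieldInfty).comap C.toInfty

/-- The order of vanishing of a (nonzero) rational function at a point. -/
def ord (P : C.Point) (h : C.FunctionField) : ℤ := -WithZero.log (C.valuationAt P h)

lemma ord_mul (P : C.Point) {h₁ h₂ : C.FunctionField} (h1 : h₁ ≠ 0) (h2 : h₂ ≠ 0) :
    C.ord P (h₁ * h₂) = C.ord P h₁ + C.ord P h₂ := by
  rw [ord, map_mul, WithZero.log_mul ((C.valuationAt P).ne_zero_iff.2 h1)
    ((C.valuationAt P).ne_zero_iff.2 h2), neg_add, ord, ord]

lemma ord_one (P : C.Point) : C.ord P 1 = 0 := by simp [ord]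

lemma ord_inv (P : C.Point) (h : C.FunctionField) : C.ord P h⁻¹ = -C.ord P h := by
  simp [ord]

/-- The field `ℚ(P)` generated by the coordinates of a point. -/
def Point.field {C : OddHyperellipticCurve g} : C.Point → IntermediateField ℚ Qbar
  | .affine x y _ => IntermediateField.adjoin ℚ {x, y}
  | .infinity => ⊥

/-- The degree `[ℚ(P) : ℚ]` of a point. -/
def Point.degree {C : OddHyperellipticCurve g} (P : C.Point) : ℕ := Module.finrank ℚ P.field

/-- The action of the absolute Galois group of `ℚ` on points. -/
def Point.galois {C : OddHyperellipticCurve g} (σ : Qbar ≃ₐ[ℚ] Qbar) : C.Point → C.Point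
  | .affine x y h => .affine (σ x) (σ y) (by
      have e : C.fBar.eval (σ x) = σ (C.fBar.eval x) := by
        rw [fBar, eval_map_algebraMap, eval_map_algebraMap]
        exact aeval_algHom_apply σ.toAlgHom x C.f
      rw [e, ← h, map_pow])
  | .infinity => .infinity

/-- Divisors on the curve over `Qbar`: finite formal `ℤ`-linear combinations of points. -/
abbrev Divisor : Type := C.Point →₀ ℤ

/-- The action of the absolute Galois group of `ℚ` on divisors. -/
def galoisDivisor (σ : Qbar ≃ₐ[ℚ] Qbar) : C.Divisor →+ C.Divisor :=
  Finsupp.mapDomain.addMonoidHom (Point.galois σ)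

/-- The degree of a divisor, the sum of its coefficients. -/
def divisorDegree : C.Divisor →+ ℤ := Finsupp.liftAddHom fun _ ↦ AddMonoidHom.id ℤ

/-- The group of principal divisors, that is, divisors of nonzero rational functions on the curve
over `Qbar`. -/
def principalDivisors : AddSubgroup C.Divisor where
  carrier := {D | ∃ h : C.FunctionField, h ≠ 0 ∧ ∀ P, D P = C.ord P h}
  zero_mem' := ⟨1, one_ne_zero, fun P ↦ by rw [ord_one]; rfl⟩
  add_mem' := by
    rintro D E ⟨h, h0, hD⟩ ⟨k, k0, hE⟩
    exact ⟨h * k, mul_ne_zero h0 k0, fun P ↦ by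
      rw [ord_mul C P h0 k0, Finsupp.add_apply, hD, hE]⟩
  neg_mem' := by
    rintro D ⟨h, h0, hD⟩
    exact ⟨h⁻¹, inv_ne_zero h0, fun P ↦ by rw [ord_inv, Finsupp.neg_apply, hD]⟩

/-- The group of divisors of degree zero. -/
abbrev divisorsDegreeZero : AddSubgroup C.Divisor := C.divisorDegree.ker

/-- The group `J(Qbar)` of geometric points of the Jacobian: divisors of degree zero modulo
linear equivalence, on the curve over `Qbar`. -/
abbrev Jacobian : Type :=
  C.divisorsDegreeZero ⧸ C.principalDivisors.addSubgroupOf C.divisorsDegreeZero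

/-- The divisors of degree zero whose class is Galois invariant: `σ D` is linearly
equivalent to `D` for all `σ`. -/
def divisorsInvariantClass : AddSubgroup C.divisorsDegreeZero where
  carrier := {D | ∀ σ : Qbar ≃ₐ[ℚ] Qbar, C.galoisDivisor σ D - D ∈ C.principalDivisors}
  zero_mem' := fun σ ↦ by simp [zero_mem]
  add_mem' := by
    intro D E hD hE σ
    have := add_mem (hD σ) (hE σ)
    rwa [AddSubgroup.coe_add, map_add, add_sub_add_comm]
  neg_mem' := by
    intro D hD σ
    have := neg_mem (hD σ)
    rwa [AddSubgroup.coe_neg, map_neg, neg_sub_neg, ← neg_sub]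

/-- The Mordell-Weil group `J(ℚ)`: the Galois invariant elements of `J(Qbar)`. -/
def jacobianRationalPoints : AddSubgroup C.Jacobian :=
  C.divisorsInvariantClass.map (QuotientAddGroup.mk' _)

end OddHyperellipticCurve

end

open Polynomial

/-! ### Maximal ideals of the affine coordinate ring. -/

namespace DoubleCoverRing

variable {K : Type*} [Field K] (h : K[X])

/-! Let `P` be a point of degree `d = g + 1`; it is affine, since infinity is rational. The sum of
its `d` conjugates minus `d` times infinity is Galois invariant of degree zero, so it is the divisor
of a function `u` because `J(ℚ) = 0` (`exists_ord_eq_of_degree`). Having no affine poles, `u` lies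
in the affine coordinate ring (`exists_algebraMap_eq_of_ord_nonneg`), so `u = p(X) + q(X) Y`.

At infinity `X` has a pole of order 2 and `Y` one of order `2g + 1`. The two terms of `u` therefore
have pole orders of opposite parity and cannot cancel, so the pole order of `u` is even or at least
`2g + 1` (`exists_ord_infinity_eq`). But `g + 1` is odd and less than `2g + 1`.

All orders at infinity are measured as multiples of the order of `S`. That `S` is a uniformizer is
never needed: positivity of its order is enough. -/

lemma evalAt_y (a b : K) (hab : b ^ 2 = h.eval a) : evalAt h a b hab (y h) = b :=
  AdjoinRoot.lift_root _

/-- Over an algebraically closed field, every nonzero prime of the coordinate ring is the ideal of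
a point. -/
theorem exists_eq_pointIdeal [IsAlgClosed K] [NeZero (2 : K)]
    [Fact (Squarefree h ∧ 0 < h.natDegree)]
    (v : IsDedekindDomain.HeightOneSpectrum (DoubleCoverRing h)) :
    ∃ (a b : K) (hab : b ^ 2 = h.eval a), v = pointIdeal h a b hab := by
  have hv : v.asIdeal.IsMaximal := v.isMaximal
  have hm := Ideal.isMaximal_comap_of_isIntegral_of_isMaximal (R := K[X]) v.asIdeal
  obtain ⟨s, hs⟩ := IsPrincipalIdealRing.principal
    (v.asIdeal.comap (algebraMap K[X] (DoubleCoverRing h)))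
  rw [Ideal.submodule_span_eq] at hs
  -- The case `s = 0` is not excluded: its degree is `⊥` and any `a` is a root. Maximality of the
  -- contracted ideal settles `heq` either way.
  have hs0 : s.degree ≠ 0 := by
    intro e
    apply hm.ne_top
    rw [hs, Ideal.span_singleton_eq_top]
    exact isUnit_iff_degree_eq_zero.2 e
  obtain ⟨a, ha⟩ := IsAlgClosed.exists_root s hs0
  have hle : v.asIdeal.comap (algebraMap K[X] (DoubleCoverRing h))
      ≤ RingHom.ker (evalRingHom a) := by
    rw [hs, Ideal.span_singleton_le_iff_mem]
    exact ha
  have heq := hm.eq_of_le (RingHom.ker_ne_top _) hle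
  have hmem (p : K[X]) (hp : p.eval a = 0) : algebraMap K[X] (DoubleCoverRing h) p ∈ v.asIdeal := by
    rw [← Ideal.mem_comap, heq]
    exact hp
  -- Modulo `v`, `y² = h(a) = b₀²`; primality then chooses the sign of the square root.
  obtain ⟨b₀, hb₀⟩ := IsAlgClosed.exists_pow_nat_eq (h.eval a) two_pos
  have hprod : (y h - algebraMap K[X] _ (C b₀)) * (y h + algebraMap K[X] _ (C b₀)) ∈ v.asIdeal := by
    have e : (y h - algebraMap K[X] _ (C b₀)) * (y h + algebraMap K[X] _ (C b₀))
        = algebraMap K[X] _ (h - C b₀ ^ 2) := by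
      rw [map_sub, map_pow, ← y_sq]; ring
    rw [e]
    exact hmem _ (by simp [hb₀])
  obtain ⟨b, hab, hb⟩ : ∃ b : K, b ^ 2 = h.eval a ∧
      y h - algebraMap K[X] _ (C b) ∈ v.asIdeal := by
    rcases v.isPrime.mem_or_mem hprod with H | H
    · exact ⟨b₀, hb₀, H⟩
    · exact ⟨-b₀, by rw [neg_sq, hb₀], by simpa using H⟩
  refine ⟨a, b, hab, ?_⟩
  ext1
  refine ((pointIdeal h a b hab).isMaximal.eq_of_le hv.ne_top fun r hr ↦ ?_).symm
  obtain ⟨p, q, rfl⟩ := exists_rep h r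
  replace hr : evalAt h a b hab (algebraMap K[X] _ p + algebraMap K[X] _ q * y h) = 0 := hr
  rw [map_add, map_mul, evalAt_algebraMap, evalAt_algebraMap, evalAt_y] at hr
  -- Modulo `y - b` the function becomes `p + q b`, a polynomial in `x` that vanishes at `a`.
  have e : algebraMap K[X] _ p + algebraMap K[X] _ q * y h
      = algebraMap K[X] _ (p + q * C b) + algebraMap K[X] _ q * (y h - algebraMap K[X] _ (C b)) := by
    rw [map_add, map_mul]; ring
  rw [e]
  exact add_mem (hmem _ (by simpa using hr)) (Ideal.mul_mem_left _ _ hb)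

end DoubleCoverRing

/-! ### Regular functions on the affine curve. -/

namespace OddHyperellipticCurve

variable {g : ℕ} (C : OddHyperellipticCurve g)

/-- A function without poles at the affine points lies in the affine coordinate ring. -/
theorem exists_algebraMap_eq_of_ord_nonneg {h : C.FunctionField} (h0 : h ≠ 0)
    (hord : ∀ x y hxy, 0 ≤ C.ord (.affine x y hxy) h) :
    ∃ r, algebraMap (DoubleCoverRing C.fBar) C.FunctionField r = h := by
  -- A Dedekind domain is the intersection of its valuation rings, and each of these comes from an
  -- affine point.
  apply IsDedekindDomain.HeightOneSpectrum.mem_integers_of_valuation_le_one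
  intro v
  obtain ⟨a, b, hab, rfl⟩ := DoubleCoverRing.exists_eq_pointIdeal C.fBar v
  have := hord a b hab
  rw [ord, Left.nonneg_neg_iff,
    WithZero.log_le_iff_le_exp ((Valuation.ne_zero_iff _).2 h0), WithZero.exp_zero] at this
  exact this

/-! ### Orders at the point at infinity. -/

lemma evalInfty : (0 : Qbar) ^ 2 = C.fInfty.eval 0 := by
  rw [← coeff_zero_eq_eval_zero, coeff_zero_fInfty]; simp

/-- The normalized valuation at infinity, on the function field of the chart at infinity. -/
noncomputable def valInfty : Valuation C.FunctionFieldInfty (WithZero (Multiplicative ℤ)) :=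
  (DoubleCoverRing.pointIdeal C.fInfty 0 0 C.evalInfty).valuation C.FunctionFieldInfty

lemma S_sq : C.S ^ 2 = algebraMap (DoubleCoverRing C.fInfty) _ (algebraMap Qbar[X] _ C.fInfty) := by
  rw [S, ← map_pow, DoubleCoverRing.y_sq]

lemma S_ne_zero : C.S ≠ 0 := by
  intro e
  have h := C.S_sq
  rw [e, zero_pow two_ne_zero, eq_comm, map_eq_zero_iff _ (IsFractionRing.injective _ _),
    map_eq_zero_iff _ (DoubleCoverRing.algebraMap_injective _)] at h
  exact C.coeff_one_fInfty (by rw [h, coeff_zero])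

lemma valInfty_poly_eq_one {p : Qbar[X]} (hp : p.coeff 0 ≠ 0) :
    C.valInfty (algebraMap (DoubleCoverRing C.fInfty) _ (algebraMap Qbar[X] _ p)) = 1 := by
  rw [valInfty, IsDedekindDomain.HeightOneSpectrum.valuation_eq_one_iff_notMem]
  intro hm
  replace hm : DoubleCoverRing.evalAt C.fInfty 0 0 C.evalInfty (algebraMap Qbar[X] _ p) = 0 := hm
  rw [DoubleCoverRing.evalAt_algebraMap, ← coeff_zero_eq_eval_zero] at hm
  exact hp hm

lemma log_valInfty_S_neg : WithZero.log (C.valInfty C.S) < 0 := by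
  rw [WithZero.log_lt_iff_lt_exp ((Valuation.ne_zero_iff _).2 C.S_ne_zero), WithZero.exp_zero,
    valInfty, S, IsDedekindDomain.HeightOneSpectrum.valuation_lt_one_iff_mem]
  exact DoubleCoverRing.evalAt_y C.fInfty 0 0 C.evalInfty

/-- `fInfty` has a simple zero at `T = 0`, so `S²` is `T` times a unit at infinity. -/
lemma log_valInfty_T : WithZero.log (C.valInfty C.T) = 2 * WithZero.log (C.valInfty C.S) := by
  have hf : C.fInfty = X * C.fInfty.divX := by
    conv_lhs => rw [← X_mul_divX_add C.fInfty, coeff_zero_fInfty, C_0, add_zero]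
  have h := congrArg C.valInfty (C.S_sq.trans (congrArg (fun p ↦ algebraMap
    (DoubleCoverRing C.fInfty) C.FunctionFieldInfty (algebraMap Qbar[X] _ p)) hf))
  rw [map_mul, map_mul, map_mul, valInfty_poly_eq_one C (p := C.fInfty.divX) (by
    rw [coeff_divX]; exact C.coeff_one_fInfty), mul_one, map_pow] at h
  have h' := congrArg WithZero.log h
  rw [WithZero.log_pow, nsmul_eq_mul] at h'
  exact h'.symm

/-- Multiplying `p(1/T)` by `T ^ deg p` gives the reversed polynomial, whose constant term is the
leading coefficient of `p`; it is thus a unit at infinity. -/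
lemma log_valInfty_polyToInfty {p : Qbar[X]} (hp : p ≠ 0) :
    WithZero.log (C.valInfty (C.polyToInfty p)) =
      -(2 * p.natDegree) * WithZero.log (C.valInfty C.S) := by
  have h := congrArg C.valInfty (C.polyToInfty_mul_pow p p.natDegree le_rfl)
  rw [valInfty_poly_eq_one C (by
    rw [coeff_reflect, revAt_le (Nat.zero_le _)]; exact leadingCoeff_ne_zero.2 hp)] at h
  have h' := congrArg WithZero.log h
  have hp' : C.polyToInfty p ≠ 0 := (map_ne_zero_iff _ C.polyToInfty_injective).2 hp
  rw [map_mul, WithZero.log_mul ((Valuation.ne_zero_iff _).2 hp')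
    ((Valuation.ne_zero_iff _).2 (pow_ne_zero _ C.T_ne_zero)), map_pow, WithZero.log_pow,
    log_valInfty_T, nsmul_eq_mul, WithZero.log_one] at h'
  linear_combination h'

/-- In units of the order of `S`, `Y = S / T ^ (g + 1)` has order `1 - 2(g + 1) = -(2g + 1)`. -/
lemma log_valInfty_polyToInfty_mul {q : Qbar[X]} (hq : q ≠ 0) :
    WithZero.log (C.valInfty (C.polyToInfty q * (C.S / C.T ^ (g + 1)))) =
      -(2 * q.natDegree + 2 * g + 1) * WithZero.log (C.valInfty C.S) := by
  have hq' : C.polyToInfty q ≠ 0 := (map_ne_zero_iff _ C.polyToInfty_injective).2 hq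
  have hS := (Valuation.ne_zero_iff C.valInfty).2 C.S_ne_zero
  have hT := (Valuation.ne_zero_iff C.valInfty).2 (pow_ne_zero (g + 1) C.T_ne_zero)
  rw [map_mul, map_div₀, WithZero.log_mul ((Valuation.ne_zero_iff _).2 hq') (div_ne_zero hS hT),
    WithZero.log_div hS hT, map_pow, WithZero.log_pow, log_valInfty_T, nsmul_eq_mul,
    log_valInfty_polyToInfty C hq]
  push_cast
  ring

lemma ord_infinity_algebraMap (p q : Qbar[X]) :
    C.ord .infinity (algebraMap (DoubleCoverRing C.fBar) _
      (algebraMap Qbar[X] _ p + algebraMap Qbar[X] _ q * DoubleCoverRing.y C.fBar)) =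
    -WithZero.log (C.valInfty (C.polyToInfty p + C.polyToInfty q * (C.S / C.T ^ (g + 1)))) := by
  have e : C.toInfty (algebraMap (DoubleCoverRing C.fBar) _
      (algebraMap Qbar[X] _ p + algebraMap Qbar[X] _ q * DoubleCoverRing.y C.fBar)) =
      C.polyToInfty p + C.polyToInfty q * (C.S / C.T ^ (g + 1)) := by
    have h1 (s : Qbar[X]) : C.ringToInfty (algebraMap Qbar[X] _ s) = C.polyToInfty s :=
      AdjoinRoot.lift_of _
    have h2 : C.ringToInfty (DoubleCoverRing.y C.fBar) = C.S / C.T ^ (g + 1) :=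
      AdjoinRoot.lift_root _
    rw [toInfty, IsFractionRing.lift_algebraMap, map_add, map_mul, h1, h1, h2]
  rw [← e]
  rfl

/-- The pole order at infinity of a function regular on the affine curve is, up to a fixed
positive factor, an element of the semigroup generated by `2` and `2g + 1`. -/
theorem exists_ord_infinity_eq {r : DoubleCoverRing C.fBar} (hr : r ≠ 0) :
    ∃ n : ℕ, C.ord .infinity (algebraMap _ C.FunctionField r) =
      n * WithZero.log (C.valInfty C.S) ∧ (Even n ∨ 2 * g + 1 ≤ n) := by
  obtain ⟨p, q, rfl⟩ := DoubleCoverRing.exists_rep C.fBar r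
  rw [ord_infinity_algebraMap]
  have hL := C.log_valInfty_S_neg
  rcases eq_or_ne q 0 with rfl | hq
  · have hp : p ≠ 0 := by rintro rfl; simp at hr
    refine ⟨2 * p.natDegree, ?_, .inl (even_two_mul _)⟩
    rw [map_zero, zero_mul, add_zero, log_valInfty_polyToInfty C hp]
    push_cast
    ring
  have hq2 := log_valInfty_polyToInfty_mul C hq
  have hq0 : C.valInfty (C.polyToInfty q * (C.S / C.T ^ (g + 1))) ≠ 0 :=
    (Valuation.ne_zero_iff _).2 (mul_ne_zero ((map_ne_zero_iff _ C.polyToInfty_injective).2 hq)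
      (div_ne_zero C.S_ne_zero (pow_ne_zero _ C.T_ne_zero)))
  rcases eq_or_ne p 0 with rfl | hp
  · refine ⟨2 * q.natDegree + 2 * g + 1, ?_, .inr (by omega)⟩
    rw [map_zero, zero_add, hq2]
    push_cast
    ring
  have hp2 := log_valInfty_polyToInfty C hp
  have hp0 : C.valInfty (C.polyToInfty p) ≠ 0 :=
    (Valuation.ne_zero_iff _).2 ((map_ne_zero_iff _ C.polyToInfty_injective).2 hp)
  -- One side is even and the other odd, so one term strictly dominates at infinity.
  rcases lt_or_gt_of_ne (show 2 * p.natDegree ≠ 2 * q.natDegree + 2 * g + 1 by omega) with hlt | hlt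
  · refine ⟨2 * q.natDegree + 2 * g + 1, ?_, .inr (by omega)⟩
    rw [Valuation.map_add_eq_of_lt_right, hq2]
    · push_cast
      ring
    · rw [← WithZero.log_lt_log hp0 hq0, hp2, hq2]
      zify at hlt
      nlinarith
  · refine ⟨2 * p.natDegree, ?_, .inl (even_two_mul _)⟩
    rw [Valuation.map_add_eq_of_lt_left, hp2]
    · push_cast
      ring
    · rw [← WithZero.log_lt_log hq0 hp0, hp2, hq2]
      zify at hlt
      nlinarith

/-! ### From a point of degree `d` to a function. -/

/-- An invariant divisor has an invariant class, hence defines an element of `J(ℚ)`. Only this easy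
direction is needed. -/
lemma mem_principalDivisors_of_jacobianRationalPoints_eq_bot (hJ : C.jacobianRationalPoints = ⊥)
    {D : C.Divisor} (hdeg : C.divisorDegree D = 0) (hD : ∀ σ, C.galoisDivisor σ D = D) :
    D ∈ C.principalDivisors := by
  have hmem : (QuotientAddGroup.mk' _ ⟨D, hdeg⟩ : C.Jacobian) ∈ C.jacobianRationalPoints :=
    AddSubgroup.mem_map_of_mem _ fun σ ↦ by simp [hD σ, zero_mem]
  rw [hJ, AddSubgroup.mem_bot] at hmem
  exact (QuotientAddGroup.eq_zero_iff (⟨D, hdeg⟩ : C.divisorsDegreeZero)).1 hmem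

/-- The image of an affine point under an embedding of its field of definition. -/
noncomputable def conjugatePoint {x y : Qbar} (h : y ^ 2 = C.fBar.eval x)
    (φ : IntermediateField.adjoin ℚ {x, y} →ₐ[ℚ] Qbar) : C.Point :=
  .affine (φ ⟨x, IntermediateField.subset_adjoin _ _ (by simp)⟩)
    (φ ⟨y, IntermediateField.subset_adjoin _ _ (by simp)⟩) (by
      rw [fBar, eval_map_algebraMap] at h ⊢
      rw [aeval_algHom_apply, ← map_pow]
      congr 1
      apply Subtype.ext
      rw [← IntermediateField.coe_val, map_pow, ← aeval_algHom_apply]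
      exact h)

lemma galois_conjugatePoint {x y : Qbar} (h : y ^ 2 = C.fBar.eval x)
    (φ : IntermediateField.adjoin ℚ {x, y} →ₐ[ℚ] Qbar) (σ : Qbar ≃ₐ[ℚ] Qbar) :
    (C.conjugatePoint h φ).galois σ = C.conjugatePoint h (σ.toAlgHom.comp φ) := rfl

/-- The sum of the conjugates of an affine point of degree `d`, minus `d` times infinity, is
principal when `J(ℚ) = 0`. -/
theorem exists_ord_eq_of_degree (hJ : C.jacobianRationalPoints = ⊥) {x y : Qbar}
    (h : y ^ 2 = C.fBar.eval x) :
    ∃ u : C.FunctionField, u ≠ 0 ∧ (∀ a b hab, 0 ≤ C.ord (.affine a b hab) u) ∧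
      C.ord .infinity u = -(Point.degree (C := C) (.affine x y h) : ℤ) := by
  classical
  have : Algebra.IsAlgebraic ℚ Qbar := by
    convert AlgebraicClosure.isAlgebraic ℚ
    · rfl
    · exact Subsingleton.elim (α := Algebra ℚ Qbar) _ _
  have : FiniteDimensional ℚ (IntermediateField.adjoin ℚ {x, y}) :=
    IntermediateField.finiteDimensional_adjoin fun z _ ↦ Algebra.IsIntegral.isIntegral z
  set d := Point.degree (C := C) (.affine x y h)
  -- Separability in characteristic zero: there are as many embeddings into `Qbar` as the degree.
  have hcard : Fintype.card (IntermediateField.adjoin ℚ {x, y} →ₐ[ℚ] Qbar) = d :=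
    AlgHom.card ℚ _ _
  -- Summing over embeddings rather than over the set of conjugates avoids proving that the
  -- conjugate points are distinct.
  set D : C.Divisor := ∑ φ, Finsupp.single (C.conjugatePoint h φ) 1
    - Finsupp.single .infinity (d : ℤ) with hDdef
  have hdeg : C.divisorDegree D = 0 := by
    have hs (P : C.Point) (n : ℤ) : C.divisorDegree (Finsupp.single P n) = n := by
      simp [divisorDegree]
    rw [hDdef, map_sub, map_sum]
    simp [hs, hcard]
  have hgal (σ) : C.galoisDivisor σ D = D := by
    rw [hDdef, map_sub, map_sum]
    congr 1
    · simp only [galoisDivisor, Finsupp.mapDomain.addMonoidHom_apply, Finsupp.mapDomain_single,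
        galois_conjugatePoint]
      -- Composition with `σ` permutes the embeddings.
      exact Fintype.sum_equiv (AlgEquiv.arrowCongr AlgEquiv.refl σ) _ _ fun φ ↦ rfl
    · simp only [galoisDivisor, Finsupp.mapDomain.addMonoidHom_apply, Finsupp.mapDomain_single]
      rfl
  obtain ⟨u, hu0, hu⟩ := C.mem_principalDivisors_of_jacobianRationalPoints_eq_bot hJ hdeg hgal
  refine ⟨u, hu0, fun a b hab ↦ ?_, ?_⟩
  · rw [← hu, hDdef, Finsupp.sub_apply, Finsupp.finsetSum_apply,
      Finsupp.single_eq_of_ne (by simp), sub_zero]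
    refine Finset.sum_nonneg fun φ _ ↦ ?_
    rw [Finsupp.single_apply]
    split_ifs <;> simp
  · rw [← hu, hDdef, Finsupp.sub_apply, Finsupp.finsetSum_apply, Finsupp.single_eq_same,
      Finset.sum_eq_zero fun φ _ ↦ Finsupp.single_eq_of_ne (by simp [conjugatePoint]), zero_sub]

end OddHyperellipticCurve

/-! ### The parity and size contradiction. -/

theorem mainTheorem10 (g : ℕ) (hg : 2 ≤ g) (hgeven : Even g) (C : OddHyperellipticCurve g)
    (hJ : C.jacobianRationalPoints = ⊥) :
    ¬ ∃ P : C.Point, P.degree = g + 1 := by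
  rintro ⟨P, hP⟩
  cases P with
  | infinity =>
    have h1 : OddHyperellipticCurve.Point.degree (.infinity : C.Point) = 1 :=
      IntermediateField.finrank_bot
    omega
  | affine x y h =>
    obtain ⟨u, hu0, hu, hinf⟩ := C.exists_ord_eq_of_degree hJ h
    obtain ⟨r, rfl⟩ := C.exists_algebraMap_eq_of_ord_nonneg hu0 hu
    have hr : r ≠ 0 := by rintro rfl; simp at hu0
    obtain ⟨n, hn, hn'⟩ := C.exists_ord_infinity_eq hr
    have hL := C.log_valInfty_S_neg
    -- `k` is the order of `S` at infinity. The argument needs only `n * k = g + 1`: an even `n`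
    -- would make `g + 1` even, and `n ≥ 2g + 1` is too large.
    obtain ⟨k, hk⟩ := Int.eq_ofNat_of_zero_le (neg_nonneg.2 hL.le)
    have hkn : n * k = g + 1 := by
      rw [hinf, hP, neg_eq_iff_eq_neg.1 hk] at hn
      zify
      push_cast at hn
      linarith
    rcases hn' with he | hge
    · have : Even (g + 1) := hkn ▸ he.mul_right k
      exact (Nat.even_add_one.1 this) hgeven
    · have hk0 : 0 < k := Nat.pos_of_ne_zero (by rintro rfl; omega)
      have : n ≤ g + 1 := hkn ▸ Nat.le_mul_of_pos_right n hk0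
      omega
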